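/- Let $d, r$ be non-negative integers. For an invertible real $d\times d$ matrix $C$ and $f \in L^2(\mathbb{R}^d)$ (complex valued), put $T_a f = f(\cdot - a)$ for $a\in\mathbb{R}^d$, $D_C f = |\det C|^{1/2} f(C\,\cdot)$, and $\widetilde D_C f = |\det C|\, f(C\,\cdot)$. The Fourier transform on $L^2(\mathbb{R}^d)$ is normalized by $\hat f(\xi) = \int f(x) e^{-2\pi i x\cdot \xi}\,dx$ for $f\in L^1\cap L^2$, and $C^*$ denotes the transpose of $C$. A matrix is expansive if all its eigenvalues have modulus strictly greater than $1$ (in particular it is invertible). For $\Psi = (\psi_1,\dots,\psi_r)$ in $L^2(\mathbb{R}^d)$, the quasi-affine system $\mathcal{U}^q_C(\Psi)$ is the family $(u_{n,z,i})$ indexed by $n\in\mathbb{Z}$, $z\in\mathbb{Z}^d$, $1\le i\le r$, where $u_{n,z,i} = D_C^n T_z\psi_i$ if $n\ge 0$ and $u_{n,z,i} = T_z \widetilde D_C^{\,n}\psi_i$ if $n<0$. A family $(x_j)_{j\in J}$ in a Hilbert space $H$ is Bessel if there is a constant $M<\infty$ with $\sum_j |\langle v,x_j\rangle|^2 \le M\|v\|^2$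 for all $v\in H$; two Bessel families $(x_j)_{j\in J}$, $(y_j)_{j\in J}$ with the same index set are orthogonal if $\sum_j \langle v,x_j\rangle y_j = 0$ for all $v\in H$ (the sum converging unconditionally). Theorem. Let $A$ be an expansive $d\times d$ matrix with integer entries and let $B$ be any expansive real $d\times d$ matrix with $A\ne B$. Let $\Psi=(\psi_1,\dots,\psi_r)$ and $\Phi=(\phi_1,\dots,\phi_r)$ be in $L^2(\mathbb{R}^d)$, and suppose that $\mathcal{U}^q_A(\Psi)$ and $\mathcal{U}^q_B(\Phi)$ are Bessel. Then for all $k\in\mathbb{Z}^d$ and $1\le i\le r$ the series $\sum_{j>0} \overline{\hat\psi_i(A^{*j}\xi)}\,\hat\phi_i(B^{*j}(\xi+k))$ converges absolutely for a.e. $\xi$, and $\mathcal{U}^q_A(\Psi)$ and $\mathcal{U}^q_B(\Phi)$ are orthogonal if and only if both of the following hold: (1) for every $k\in\mathbb{Z}^d$, $\sum_{i=1}^r \overline{\hat\psi_i(\xi)}\,\hat\phi_i(\xi+k) = 0$ for a.e. $\xi\in\mathbb{R}^d$; (2) for every $k\in\mathbb{Z}^d$, $\sum_{i=1}^r\sum_{j>0}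 \overline{\hat\psi_i(A^{*j}\xi)}\,\hat\phi_i(B^{*j}(\xi+k)) = 0$ for a.e. $\xi\in\mathbb{R}^d$. -/

import Mathlib

open MeasureTheory
open scoped FourierTransform MatrixGroups

noncomputable section

namespace QuasiAffine

/-- Euclidean space `ℝ^d`. -/
abbrev Eu (d : ℕ) : Type := EuclideanSpace ℝ (Fin d)

/-- The Hilbert space `L²(ℝ^d)` of complex valued functions, with Lebesgue measure. -/
abbrev L2 (d : ℕ) : Type := Lp (α := Eu d) ℂ 2 (volume : Measure (Eu d))

/-- The point of `ℝ^d` with the integer coordinates `k`. -/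
def intPt {d : ℕ} (k : Fin d → ℤ) : Eu d := WithLp.toLp 2 (fun i => (k i : ℝ))

/-- A matrix is expansive if all its (complex) eigenvalues have modulus greater than `1`. -/
def IsExpansive {d : ℕ} (A : Matrix (Fin d) (Fin d) ℝ) : Prop :=
  ∀ μ : ℂ, Module.End.HasEigenvalue (Matrix.toLin' (A.map (algebraMap ℝ ℂ))) μ → 1 < ‖μ‖

/-- A matrix is integral if all its entries are integers. -/
def IsIntegralMatrix {d : ℕ} (A : Matrix (Fin d) (Fin d) ℝ) : Prop :=
  ∀ i j, ∃ n : ℤ, A i j = n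

/-! ### Bessel families and orthogonality in a Hilbert space -/

section Hilbert

variable {H : Type*} [NormedAddCommGroup H] [InnerProductSpace ℂ H] {J : Type*}

/-- The family `x` is Bessel: `∑ |⟨v, x j⟩|² ≤ C ‖v‖²` for all `v`. -/
def IsBessel (x : J → H) : Prop :=
  ∃ C : ℝ, ∀ v : H, Summable (fun j => ‖inner ℂ (x j) v‖ ^ 2) ∧
    ∑' j, ‖inner ℂ (x j) v‖ ^ 2 ≤ C * ‖v‖ ^ 2

/-- The families `x` and `y` are orthogonal: `∑ ⟨v, x j⟩ y j = 0` for all `v`.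
(Mathlib's inner product is linear in its second argument.) -/
def AreOrthogonal (x y : J → H) : Prop :=
  ∀ v : H, HasSum (fun j => inner ℂ (x j) v • y j) 0

end Hilbert

/-! ### Translations and dilations on `L²(ℝ^d)` -/

variable {d : ℕ}

/-- The translation `T_a f = f(· - a)`. -/
def translation (a : Eu d) (f : L2 d) : L2 d :=
  Lp.compMeasurePreserving (fun x : Eu d => x - a) (measurePreserving_sub_right volume a) f

theorem det_toEuclideanLin_ne_zero (A : GL (Fin d) ℝ) :
    LinearMap.det (Matrix.toEuclideanLin (A : Matrix (Fin d) (Fin d) ℝ)) ≠ 0 := by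
  rw [LinearMap.det_toLpLin]
  exact A.det.ne_zero

theorem memLp_comp (A : GL (Fin d) ℝ) (f : L2 d) :
    MemLp (fun x : Eu d => f (Matrix.toEuclideanLin (A : Matrix (Fin d) (Fin d) ℝ) x)) 2
      volume := by
  have hmap := Measure.map_linearMap_addHaar_eq_smul_addHaar (volume : Measure (Eu d))
    (det_toEuclideanLin_ne_zero A)
  have hm : AEMeasurable (Matrix.toEuclideanLin (A : Matrix (Fin d) (Fin d) ℝ)) volume :=
    (LinearMap.continuous_of_finiteDimensional _).aemeasurable
  have h : MemLp f 2 (Measure.map (Matrix.toEuclideanLin (A : Matrix (Fin d) (Fin d) ℝ))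
      volume) := by
    rw [hmap]
    exact (Lp.memLp f).smul_measure ENNReal.ofReal_ne_top
  exact (memLp_map_measure_iff h.1 hm).1 h

/-- The composition `f(A ·)` of `f ∈ L²(ℝ^d)` with an invertible matrix. -/
def compMat (A : GL (Fin d) ℝ) (f : L2 d) : L2 d := (memLp_comp A f).toLp _

theorem compMat_ae (A : GL (Fin d) ℝ) (f : L2 d) :
    ∀ᵐ x, compMat A f x = f (Matrix.toEuclideanLin (A : Matrix (Fin d) (Fin d) ℝ) x) :=
  (memLp_comp A f).coeFn_toLp

theorem quasiMP (A : GL (Fin d) ℝ) :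
    Measure.QuasiMeasurePreserving
      (Matrix.toEuclideanLin (A : Matrix (Fin d) (Fin d) ℝ)) volume volume := by
  refine ⟨(LinearMap.continuous_of_finiteDimensional _).measurable, ?_⟩
  rw [Measure.map_linearMap_addHaar_eq_smul_addHaar _ (det_toEuclideanLin_ne_zero A)]
  exact Measure.smul_absolutelyContinuous

theorem compMat_compMat (A B : GL (Fin d) ℝ) (h : A * B = 1) (f : L2 d) :
    compMat B (compMat A f) = f := by
  apply Lp.ext
  filter_upwards [compMat_ae B (compMat A f), (quasiMP B).ae (compMat_ae A f)] with x h1 h2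
  rw [h1, h2]
  congr 1
  have : (A : Matrix (Fin d) (Fin d) ℝ) * (B : Matrix (Fin d) (Fin d) ℝ) = 1 := by
    rw [← Units.val_mul, h, Units.val_one]
  have h3 := Matrix.toLpLin_mul_same (p := 2) (A : Matrix (Fin d) (Fin d) ℝ)
    (B : Matrix (Fin d) (Fin d) ℝ)
  rw [this, Matrix.toLpLin_one] at h3
  exact (congrArg (fun g => g x) h3).symm

/-- `f ↦ f(A ·)` as a linear automorphism of `L²(ℝ^d)`. -/
def compMatEquiv (A : GL (Fin d) ℝ) : L2 d ≃ₗ[ℂ] L2 d where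
  toFun := compMat A
  invFun := compMat A⁻¹
  map_add' f g := by
    apply Lp.ext
    filter_upwards [compMat_ae A (f + g), compMat_ae A f, compMat_ae A g,
      Lp.coeFn_add (compMat A f) (compMat A g), (quasiMP A).ae (Lp.coeFn_add f g)]
      with x h1 h2 h3 h4 h5
    rw [h1, h4, h5, Pi.add_apply, Pi.add_apply, h2, h3]
  map_smul' c f := by
    apply Lp.ext
    filter_upwards [compMat_ae A (c • f), compMat_ae A f,
      Lp.coeFn_smul c (compMat A f), (quasiMP A).ae (Lp.coeFn_smul c f)]
      with x h1 h2 h4 h5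
    rw [h1, RingHom.id_apply, h4, h5, Pi.smul_apply, Pi.smul_apply, h2]
  left_inv f := compMat_compMat A A⁻¹ (mul_inv_cancel A) f
  right_inv f := compMat_compMat A⁻¹ A (inv_mul_cancel A) f

theorem absDet_ne_zero (A : GL (Fin d) ℝ) :
    ((|(A : Matrix (Fin d) (Fin d) ℝ).det| : ℝ) : ℂ) ≠ 0 := by
  simpa using A.det.ne_zero

theorem sqrtAbsDet_ne_zero (A : GL (Fin d) ℝ) :
    ((√|(A : Matrix (Fin d) (Fin d) ℝ).det| : ℝ) : ℂ) ≠ 0 := by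
  have : (A : Matrix (Fin d) (Fin d) ℝ).det ≠ 0 := A.det.ne_zero
  simpa [Real.sqrt_eq_zero'] using this

/-- The dilation `D_A f = |det A|^{1/2} f(A ·)`. -/
def dilation (A : GL (Fin d) ℝ) : L2 d ≃ₗ[ℂ] L2 d :=
  (compMatEquiv A).trans (LinearEquiv.smulOfNeZero ℂ (L2 d) _ (sqrtAbsDet_ne_zero A))

/-- The renormalized dilation `f ↦ |det A| f(A ·)`. -/
def renormDilation (A : GL (Fin d) ℝ) : L2 d ≃ₗ[ℂ] L2 d :=
  (compMatEquiv A).trans (LinearEquiv.smulOfNeZero ℂ (L2 d) _ (absDet_ne_zero A))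

/-- The quasi-affine system generated by `ψ 0, …, ψ (r - 1)` and the matrix `A`, indexed by
`(n, z, i) ∈ ℤ × ℤ^d × {0, …, r - 1}`: the member is `D_A^n T_z ψ_i` for `n ≥ 0`, and
`T_z D̃_A^n ψ_i` for `n < 0`, where `D̃_A` is the renormalized dilation. The powers are those
of the group of linear automorphisms of `L²(ℝ^d)`. -/
def quasiAffine (A : GL (Fin d) ℝ) {r : ℕ} (ψ : Fin r → L2 d) :
    ℤ × (Fin d → ℤ) × Fin r → L2 d :=
  fun p =>
    if 0 ≤ p.1 then (dilation A ^ p.1) (translation (intPt p.2.1) (ψ p.2.2))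
    else translation (intPt p.2.1) ((renormDilation A ^ p.1) (ψ p.2.2))

/-- The point `(A^*)^j x`, where `A^*` is the transpose of `A`. -/
def adjPow (A : GL (Fin d) ℝ) (j : ℕ) (x : Eu d) : Eu d :=
  Matrix.toEuclideanLin ((A : Matrix (Fin d) (Fin d) ℝ).transpose ^ j) x

end QuasiAffine

end

open QuasiAffine

/-!
Split the mixed frame operator `v ↦ ∑ ⟨v, x⟩ y` of the two quasi-affine systems as `R + Q`, where
`R` collects the levels `n ≥ 0` and `Q` the levels `n < 0`. In frequency, `D̃_C ^ (-j)` is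
composition with `C^* ^ j`, and both `Q` and the contribution `P` of the level `n = 0` are mixed
operators of shift-invariant systems. Such an operator commutes with integer translations, and by
Parseval on the unit cube it vanishes iff the mixed dual Gramian does: for `P` this is condition
(1), for `Q` condition (2).

It remains to see that `R + Q = 0` forces `R = 0` and `Q = 0`. The level `n ≥ 0` contributes
`D_B ^ n P D_A ^ (-n)`, so `R = 0` iff `P = 0`, and `R` satisfies the recursion
`R D_A = P D_A + D_B R`. If `R + Q = 0`, then `R = -Q` commutes with integer translations. Choose an
integer vector `a` with `A a ≠ B a`. As `D_A T_{A a} = T_a D_A` and `A a` is integral, comparing the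
recursion at `T_{A a} v` and at `v` gives `T_a D_B R v = D_B T_{A a} R v = T_{B⁻¹ A a} D_B R v`. An
`L²` function invariant under a nonzero translation vanishes, so `R v = 0`.
-/

noncomputable section

namespace QuasiAffine

section Hilbert

variable {H : Type*} [NormedAddCommGroup H] [InnerProductSpace ℂ H] {I J K : Type*}

theorem IsBessel.comp_injective {x : J → H} (hx : IsBessel x) {e : I → J}
    (he : Function.Injective e) : IsBessel (x ∘ e) := by
  obtain ⟨C, hC⟩ := hx
  exact ⟨C, fun v => ⟨(hC v).1.comp_injective he,
    (tsum_comp_le_tsum_of_inj (hC v).1 (fun _ => by positivity) he).trans (hC v).2⟩⟩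

theorem IsBessel.exists_norm_sum_smul_sq_le {y : J → H} (hy : IsBessel y) :
    ∃ C : ℝ, 0 ≤ C ∧ ∀ (c : J → ℂ) (s : Finset J),
      ‖∑ j ∈ s, c j • y j‖ ^ 2 ≤ C * ∑ j ∈ s, ‖c j‖ ^ 2 := by
  obtain ⟨C, hC⟩ := hy
  refine ⟨max C 0, le_max_right _ _, fun c s => ?_⟩
  set u := ∑ j ∈ s, c j • y j with hu
  have bessel : ∑ j ∈ s, ‖inner ℂ (y j) u‖ ^ 2 ≤ max C 0 * ‖u‖ ^ 2 :=
    ((hC u).1.sum_le_tsum s fun _ _ => by positivity).trans <| (hC u).2.trans <| by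
      gcongr; exact le_max_left _ _
  have norm_sq_le : ‖u‖ ^ 2 ≤ ∑ j ∈ s, ‖c j‖ * ‖inner ℂ (y j) u‖ := by
    have expand : inner ℂ u u = ∑ j ∈ s, c j * inner ℂ u (y j) := by
      nth_rewrite 2 [hu]
      simp only [inner_sum, inner_smul_right]
    calc ‖u‖ ^ 2 = ‖inner ℂ u u‖ := by simp [inner_self_eq_norm_sq_to_K]
      _ ≤ ∑ j ∈ s, ‖c j * inner ℂ u (y j)‖ := expand ▸ norm_sum_le _ _
      _ = ∑ j ∈ s, ‖c j‖ * ‖inner ℂ (y j) u‖ := by simp only [norm_mul, norm_inner_symm u]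
  have key : ‖u‖ ^ 2 * ‖u‖ ^ 2 ≤ (max C 0 * ∑ j ∈ s, ‖c j‖ ^ 2) * ‖u‖ ^ 2 :=
    calc ‖u‖ ^ 2 * ‖u‖ ^ 2 ≤ (∑ j ∈ s, ‖c j‖ * ‖inner ℂ (y j) u‖) ^ 2 := by
          rw [← sq]; gcongr
      _ ≤ (∑ j ∈ s, ‖c j‖ ^ 2) * ∑ j ∈ s, ‖inner ℂ (y j) u‖ ^ 2 :=
          Finset.sum_mul_sq_le_sq_mul_sq _ _ _
      _ ≤ (∑ j ∈ s, ‖c j‖ ^ 2) * (max C 0 * ‖u‖ ^ 2) := by gcongr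
      _ = (max C 0 * ∑ j ∈ s, ‖c j‖ ^ 2) * ‖u‖ ^ 2 := by ring
  rcases (sq_nonneg ‖u‖).eq_or_lt with h0 | h0
  · rw [← h0]
    positivity
  · exact le_of_mul_le_mul_right key h0

/-- The mixed frame operator `v ↦ ∑ ⟨v, x j⟩ y j` of two families of vectors. -/
def mixedOp (x y : J → H) (v : H) : H := ∑' j, inner ℂ (x j) v • y j

theorem mixedOp_comp_equiv (e : I ≃ J) (x y : J → H) : mixedOp (x ∘ e) (y ∘ e) = mixedOp x y :=
  funext fun v => e.tsum_eq fun j => inner ℂ (x j) v • y j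

/-- The family of all `U ^ n (x k)` with `n ∈ ℕ`. -/
def orbit (U : H ≃ₗᵢ[ℂ] H) (x : K → H) : ℕ × K → H := fun p => (U ^ p.1) (x p.2)

theorem IsBessel.of_orbit {U : H ≃ₗᵢ[ℂ] H} {x : K → H} (hx : IsBessel (orbit U x)) :
    IsBessel x := by
  simpa [orbit, Function.comp_def] using hx.comp_injective (Prod.mk_right_injective 0)

variable [CompleteSpace H]

theorem IsBessel.summable_smul {y : J → H} (hy : IsBessel y) {c : J → ℂ}
    (hc : Summable fun j => ‖c j‖ ^ 2) : Summable fun j => c j • y j := by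
  obtain ⟨C, hC0, hC⟩ := hy.exists_norm_sum_smul_sq_le
  rw [summable_iff_vanishing_norm] at hc ⊢
  intro ε hε
  obtain ⟨s, hs⟩ := hc (ε ^ 2 / (C + 1)) (by positivity)
  refine ⟨s, fun t ht => lt_of_pow_lt_pow_left₀ 2 hε.le ?_⟩
  have small := (le_abs_self _).trans_lt (hs t ht)
  have nonneg : (0 : ℝ) ≤ ∑ j ∈ t, ‖c j‖ ^ 2 := by positivity
  rw [lt_div_iff₀ (by positivity)] at small
  nlinarith [hC c t]

theorem IsBessel.summable_inner_smul {x y : J → H} (hx : IsBessel x) (hy : IsBessel y) (v : H) :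
    Summable fun j => inner ℂ (x j) v • y j :=
  let ⟨_, hC⟩ := hx
  hy.summable_smul (hC v).1

theorem areOrthogonal_iff_mixedOp_eq_zero {x y : J → H} (hx : IsBessel x) (hy : IsBessel y) :
    AreOrthogonal x y ↔ mixedOp x y = 0 :=
  (forall_congr' fun v => (hx.summable_inner_smul hy v).hasSum_iff).trans funext_iff.symm

theorem IsBessel.hasSum_inner_mixedOp {x y : J → H} (hx : IsBessel x) (hy : IsBessel y)
    (v w : H) :
    HasSum (fun j => inner ℂ (x j) v * inner ℂ w (y j)) (inner ℂ w (mixedOp x y v)) := by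
  simpa only [mixedOp, innerSL_apply_apply, inner_smul_right] using
    (hx.summable_inner_smul hy v).hasSum.mapL (innerSL ℂ w)

theorem inner_mixedOp_swap {x y : J → H} (hx : IsBessel x) (hy : IsBessel y) (v w : H) :
    inner ℂ (mixedOp y x w) v = inner ℂ w (mixedOp x y v) := by
  refine HasSum.unique ?_ (hx.hasSum_inner_mixedOp hy v w)
  simpa only [RCLike.star_def, map_mul, inner_conj_symm, mul_comm] using
    (hy.hasSum_inner_mixedOp hx w v).star

theorem mixedOp_eq_zero_iff_of_total {x y : J → H} (hx : IsBessel x) (hy : IsBessel y)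
    {D : Set H} (hD : ∀ u : H, (∀ v ∈ D, inner ℂ v u = 0) → u = 0) :
    mixedOp x y = 0 ↔ ∀ v ∈ D, ∀ w ∈ D, ∑' j, inner ℂ (x j) v * inner ℂ w (y j) = 0 := by
  simp only [(hx.hasSum_inner_mixedOp hy _ _).tsum_eq]
  refine ⟨fun h v _ w _ => by simp [h], fun h => funext fun v => hD _ fun w hw => ?_⟩
  have adjoint_eq_zero : mixedOp y x w = 0 := hD _ fun v hv => by
    rw [← inner_conj_symm, inner_mixedOp_swap hx hy, h v hv w hw, map_zero]
  rw [← inner_mixedOp_swap hx hy, adjoint_eq_zero, inner_zero_left]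

theorem mixedOp_map {x y : K → H} (hx : IsBessel x) (hy : IsBessel y) (U V : H →ₗᵢ[ℂ] H) (v : H) :
    mixedOp (U ∘ x) (V ∘ y) (U v) = V (mixedOp x y v) := by
  refine Eq.trans (tsum_congr fun k => ?_)
    (V.toContinuousLinearMap.map_tsum (hx.summable_inner_smul hy v)).symm
  rw [Function.comp_apply, Function.comp_apply, LinearIsometry.inner_map_map]
  exact (map_smul V _ _).symm

theorem mixedOp_sum {x y : I ⊕ J → H} (hx : IsBessel x) (hy : IsBessel y) (v : H) :
    mixedOp x y v = mixedOp (x ∘ Sum.inl) (y ∘ Sum.inl) v +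
      mixedOp (x ∘ Sum.inr) (y ∘ Sum.inr) v := by
  have h := hx.summable_inner_smul hy v
  exact (h.comp_injective Sum.inl_injective).tsum_sum (h.comp_injective Sum.inr_injective)

theorem mixedOp_prod {x y : I × K → H} (hx : IsBessel x) (hy : IsBessel y) (v : H) :
    mixedOp x y v = ∑' i, mixedOp (fun k => x (i, k)) (fun k => y (i, k)) v :=
  (hx.summable_inner_smul hy v).tsum_prod

theorem mixedOp_orbit_apply {U V : H ≃ₗᵢ[ℂ] H} {x y : K → H} (hx : IsBessel (orbit U x))
    (hy : IsBessel (orbit V y)) (v : H) :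
    mixedOp (orbit U x) (orbit V y) (U v) =
      mixedOp x y (U v) + V (mixedOp (orbit U x) (orbit V y) v) := by
  have summable_level (w : H) : Summable fun n =>
      mixedOp (fun k => orbit U x (n, k)) (fun k => orbit V y (n, k)) w :=
    (hx.summable_inner_smul hy w).prod
  have level_succ (n : ℕ) :
      mixedOp (fun k => orbit U x (n + 1, k)) (fun k => orbit V y (n + 1, k)) (U v) =
        V (mixedOp (fun k => orbit U x (n, k)) (fun k => orbit V y (n, k)) v) := by
    simp only [orbit, pow_succ', LinearIsometryEquiv.coe_mul, Function.comp_apply]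
    exact mixedOp_map (hx.comp_injective (Prod.mk_right_injective n))
      (hy.comp_injective (Prod.mk_right_injective n)) U.toLinearIsometry V.toLinearIsometry v
  rw [mixedOp_prod hx hy, mixedOp_prod hx hy, (summable_level (U v)).tsum_eq_zero_add]
  simp only [level_succ]
  congr 1
  exact (V.toLinearIsometry.toContinuousLinearMap.map_tsum (summable_level v)).symm

theorem mixedOp_orbit_eq_zero {U V : H ≃ₗᵢ[ℂ] H} {x y : K → H} (hx : IsBessel (orbit U x))
    (hy : IsBessel (orbit V y)) (h : mixedOp x y = 0) : mixedOp (orbit U x) (orbit V y) = 0 := by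
  funext v
  rw [mixedOp_prod hx hy, Pi.zero_apply]
  refine (tsum_congr fun n => ?_).trans tsum_zero
  have level := mixedOp_map hx.of_orbit hy.of_orbit (U ^ n).toLinearIsometry
    (V ^ n).toLinearIsometry ((U ^ n).symm v)
  rw [h, Pi.zero_apply, map_zero] at level
  simpa [orbit, Function.comp_def] using level

end Hilbert

variable {d : ℕ}

section Operators

theorem translation_ae (a : Eu d) (f : L2 d) : ∀ᵐ x, translation a f x = f (x - a) :=
  Lp.coeFn_compMeasurePreserving f (measurePreserving_sub_right volume a)

/-- The translation `T_a` as a linear isometry. -/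
def translationIsometry (a : Eu d) : L2 d →ₗᵢ[ℂ] L2 d :=
  Lp.compMeasurePreservingₗᵢ ℂ (fun x : Eu d => x - a) (measurePreserving_sub_right volume a)

theorem coe_translationIsometry (a : Eu d) : ⇑(translationIsometry a) = translation a := rfl

theorem translation_translation (a b : Eu d) (f : L2 d) :
    translation a (translation b f) = translation (a + b) f := by
  apply Lp.ext
  filter_upwards [translation_ae a (translation b f), translation_ae (a + b) f,
    (measurePreserving_sub_right volume a).quasiMeasurePreserving.ae (translation_ae b f)]
    with x h1 h2 h3
  rw [h1, h2, h3, sub_sub]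

/-- The linear automorphism of `ℝ^d` given by an invertible matrix. -/
def euclideanCLE (A : GL (Fin d) ℝ) : Eu d ≃L[ℝ] Eu d :=
  (LinearEquiv.ofLinearMap (Matrix.toEuclideanLin (A : Matrix (Fin d) (Fin d) ℝ))
    (Matrix.toEuclideanLin ((A⁻¹ : GL (Fin d) ℝ) : Matrix (Fin d) (Fin d) ℝ))
    (by rw [← Matrix.toLpLin_mul_same, ← Units.val_mul, mul_inv_cancel, Units.val_one,
      Matrix.toLpLin_one])
    (by rw [← Matrix.toLpLin_mul_same, ← Units.val_mul, inv_mul_cancel, Units.val_one,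
      Matrix.toLpLin_one])).toContinuousLinearEquiv

theorem coe_euclideanCLE (A : GL (Fin d) ℝ) :
    ⇑(euclideanCLE A) = Matrix.toEuclideanLin (A : Matrix (Fin d) (Fin d) ℝ) := rfl

theorem measurePreserving_euclideanCLE (A : GL (Fin d) ℝ) :
    MeasurePreserving (euclideanCLE A) volume
      (ENNReal.ofReal |(A : Matrix (Fin d) (Fin d) ℝ).det|⁻¹ • volume) := by
  refine ⟨(euclideanCLE A).continuous.measurable, ?_⟩
  rw [coe_euclideanCLE, Measure.map_linearMap_addHaar_eq_smul_addHaar _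
    (det_toEuclideanLin_ne_zero A), LinearMap.det_toLpLin, abs_inv]

theorem integral_comp_euclideanCLE {E : Type*} [NormedAddCommGroup E] [NormedSpace ℝ E]
    (A : GL (Fin d) ℝ) (h : Eu d → E) :
    ∫ x, h (euclideanCLE A x) = |(A : Matrix (Fin d) (Fin d) ℝ).det|⁻¹ • ∫ x, h x := by
  rw [(measurePreserving_euclideanCLE A).integral_comp
    (euclideanCLE A).toHomeomorph.measurableEmbedding, integral_smul_measure,
    ENNReal.toReal_ofReal (by positivity)]

theorem norm_compMat (A : GL (Fin d) ℝ) (f : L2 d) :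
    ‖compMat A f‖ = (√|(A : Matrix (Fin d) (Fin d) ℝ).det|)⁻¹ * ‖f‖ := by
  have hf : AEStronglyMeasurable f
      (ENNReal.ofReal |(A : Matrix (Fin d) (Fin d) ℝ).det|⁻¹ • volume) :=
    (Lp.aestronglyMeasurable f).mono_ac Measure.smul_absolutelyContinuous
  have h := eLpNorm_comp_measurePreserving (p := 2) hf (measurePreserving_euclideanCLE A)
  rw [eLpNorm_smul_measure_of_ne_top (by norm_num)] at h
  rw [Lp.norm_def, Lp.norm_def, eLpNorm_congr_ae (compMat_ae A f)]
  refine (congrArg ENNReal.toReal h).trans ?_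
  rw [smul_eq_mul, ENNReal.toReal_mul, ← ENNReal.toReal_rpow,
    ENNReal.toReal_ofReal (by positivity), Real.inv_rpow (abs_nonneg _), Real.sqrt_eq_rpow]
  norm_num

theorem continuous_compMat (A : GL (Fin d) ℝ) : Continuous (compMat A : L2 d → L2 d) :=
  ((compMatEquiv A).toLinearMap.mkContinuous _ fun f => (norm_compMat A f).le).continuous

theorem dilation_apply (A : GL (Fin d) ℝ) (f : L2 d) :
    dilation A f = ((√|(A : Matrix (Fin d) (Fin d) ℝ).det| : ℝ) : ℂ) • compMat A f := rfl

theorem norm_dilation (A : GL (Fin d) ℝ) (f : L2 d) : ‖dilation A f‖ = ‖f‖ := by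
  have h : 0 < √|(A : Matrix (Fin d) (Fin d) ℝ).det| :=
    Real.sqrt_pos.2 (abs_pos.2 A.det.ne_zero)
  rw [dilation_apply, norm_smul, norm_compMat, Complex.norm_real, Real.norm_of_nonneg h.le,
    mul_inv_cancel_left₀ h.ne']

/-- The dilation `D_A` as a unitary operator. -/
def dilationIsometry (A : GL (Fin d) ℝ) : L2 d ≃ₗᵢ[ℂ] L2 d where
  toLinearEquiv := dilation A
  norm_map' := norm_dilation A

theorem coe_dilationIsometry (A : GL (Fin d) ℝ) : ⇑(dilationIsometry A) = dilation A := rfl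

theorem dilationIsometry_pow_apply (A : GL (Fin d) ℝ) (n : ℕ) (f : L2 d) :
    (dilationIsometry A ^ n) f = (dilation A ^ n) f := by
  induction n with
  | zero => rfl
  | succ n ih =>
    rw [pow_succ', pow_succ', LinearIsometryEquiv.coe_mul, LinearEquiv.mul_apply,
      Function.comp_apply, ih, coe_dilationIsometry]

theorem compMat_translation (A : GL (Fin d) ℝ) (a : Eu d) (f : L2 d) :
    compMat A (translation (euclideanCLE A a) f) = translation a (compMat A f) := by
  apply Lp.ext
  filter_upwards [compMat_ae A (translation (euclideanCLE A a) f), translation_ae a (compMat A f),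
    (quasiMP A).ae (translation_ae (euclideanCLE A a) f),
    (measurePreserving_sub_right volume a).quasiMeasurePreserving.ae (compMat_ae A f)]
    with x h1 h2 h3 h4
  rw [h1, h2, h3, h4, map_sub, coe_euclideanCLE]

theorem dilation_translation (A : GL (Fin d) ℝ) (a : Eu d) (f : L2 d) :
    dilation A (translation (euclideanCLE A a) f) = translation a (dilation A f) := by
  rw [dilation_apply, dilation_apply, compMat_translation, ← coe_translationIsometry, map_smul]

end Operators

section Fourier

/-- The character `ξ ↦ e^{-2πi⟨a, ξ⟩}`. -/
def char (a ξ : Eu d) : ℂ := Real.fourierChar (-inner ℝ a ξ)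

theorem continuous_char (a : Eu d) : Continuous (char a) :=
  continuous_subtype_val.comp (Real.continuous_fourierChar.comp (by fun_prop))

theorem norm_char (a ξ : Eu d) : ‖char a ξ‖ = 1 := Circle.norm_coe _

theorem memLp_top_char (a : Eu d) : MemLp (char a) ⊤ volume :=
  memLp_top_of_bound (continuous_char a).aestronglyMeasurable 1
    (.of_forall fun ξ => (norm_char a ξ).le)

/-- Multiplication by the character `char a`. -/
def modulation (a : Eu d) : L2 d →L[ℂ] L2 d :=
  (ContinuousLinearMap.mul ℂ ℂ).holderL volume ⊤ 2 2 (memLp_top_char a).toLp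

theorem modulation_ae (a : Eu d) (f : L2 d) : ∀ᵐ ξ, modulation a f ξ = char a ξ * f ξ := by
  filter_upwards [(ContinuousLinearMap.mul ℂ ℂ).coeFn_holder (r := 2) (memLp_top_char a).toLp f,
    (memLp_top_char a).coeFn_toLp] with ξ h1 h2
  rw [modulation, ContinuousLinearMap.holderL_apply_apply, h1, h2, ContinuousLinearMap.mul_apply']

theorem schwartzMap_toLp_ae (g : SchwartzMap (Eu d) ℂ) : ∀ᵐ x, (g.toLp 2 : L2 d) x = g x :=
  g.coeFn_toLp 2 volume

theorem eq_of_eqOn_schwartzMap {X : Type*} [TopologicalSpace X] [T2Space X] {S T : L2 d → X}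
    (hS : Continuous S) (hT : Continuous T)
    (h : ∀ g : SchwartzMap (Eu d) ℂ, S (g.toLp 2) = T (g.toLp 2)) : S = T :=
  (SchwartzMap.denseRange_toLpCLM (E := Eu d) (F := ℂ) (p := 2) (μ := volume) (by simp)).equalizer
    hS hT (funext h)

theorem continuous_fourier : Continuous (𝓕 : L2 d → L2 d) :=
  (Lp.fourierTransformₗᵢ (Eu d) ℂ).continuous

theorem fourier_comp_sub_right (a : Eu d) (g : Eu d → ℂ) (ξ : Eu d) :
    𝓕 (fun x => g (x - a)) ξ = char a ξ * 𝓕 g ξ := by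
  have := congrFun (VectorFourier.fourierIntegral_comp_add_right Real.fourierChar volume
    (innerₗ (Eu d)) g (-a)) ξ
  simp only [map_neg, innerₗ_apply_apply, LinearMap.neg_apply] at this
  simp only [Circle.smul_def, ← sub_eq_add_neg] at this
  exact this

theorem fourier_translation (a : Eu d) (f : L2 d) :
    𝓕 (translation a f) = modulation a (𝓕 f) := by
  refine congrFun (eq_of_eqOn_schwartzMap (S := fun f => 𝓕 (translation a f))
    (T := fun f => modulation a (𝓕 f))
    (continuous_fourier.comp (translationIsometry a).continuous)
    ((modulation a).continuous.comp continuous_fourier) fun g => ?_) f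
  have toLp_translate : translation a (g.toLp 2 : L2 d) =
      (g.compSubConstCLM ℂ a).toLp 2 := by
    apply Lp.ext
    filter_upwards [translation_ae a (g.toLp 2), schwartzMap_toLp_ae (g.compSubConstCLM ℂ a),
      (measurePreserving_sub_right volume a).quasiMeasurePreserving.ae (schwartzMap_toLp_ae g)]
      with x h1 h2 h3
    rw [h1, h2, h3, SchwartzMap.compSubConstCLM_apply]
  simp only [toLp_translate, SchwartzMap.toLp_fourier_eq]
  apply Lp.ext
  filter_upwards [schwartzMap_toLp_ae (𝓕 (g.compSubConstCLM ℂ a)),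
    modulation_ae a ((𝓕 g).toLp 2), schwartzMap_toLp_ae (𝓕 g)] with ξ h1 h2 h3
  rw [h1, h2, h3, SchwartzMap.fourier_coe, SchwartzMap.fourier_coe]
  exact fourier_comp_sub_right a g ξ

/-- The transpose `A^*` of an invertible matrix. -/
def transposeGL (A : GL (Fin d) ℝ) : GL (Fin d) ℝ where
  val := (A : Matrix (Fin d) (Fin d) ℝ).transpose
  inv := ((A⁻¹ : GL (Fin d) ℝ) : Matrix (Fin d) (Fin d) ℝ).transpose
  val_inv := by rw [← Matrix.transpose_mul, ← Units.val_mul, inv_mul_cancel, Units.val_one,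
    Matrix.transpose_one]
  inv_val := by rw [← Matrix.transpose_mul, ← Units.val_mul, mul_inv_cancel, Units.val_one,
    Matrix.transpose_one]

theorem inner_euclideanCLE_left (A : GL (Fin d) ℝ) (x y : Eu d) :
    inner ℝ (euclideanCLE A x) y = inner ℝ x (euclideanCLE (transposeGL A) y) := by
  rw [coe_euclideanCLE, coe_euclideanCLE, ← LinearMap.adjoint_inner_right,
    ← Matrix.toEuclideanLin_conjTranspose_eq_adjoint,
    Matrix.conjTranspose_eq_transpose_of_trivial]
  rfl

theorem fourier_comp_euclideanCLE (A : GL (Fin d) ℝ) (g : Eu d → ℂ) (ξ : Eu d) :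
    𝓕 (g ∘ euclideanCLE A) (euclideanCLE (transposeGL A) ξ) =
      |(A : Matrix (Fin d) (Fin d) ℝ).det|⁻¹ • 𝓕 g ξ := by
  rw [Real.fourier_eq, Real.fourier_eq, ← integral_comp_euclideanCLE]
  simp only [inner_euclideanCLE_left, Function.comp_apply]

theorem compMat_fourier_compMat (A : GL (Fin d) ℝ) (f : L2 d) :
    compMat (transposeGL A) (𝓕 (compMat A f)) =
      |(A : Matrix (Fin d) (Fin d) ℝ).det|⁻¹ • 𝓕 f := by
  refine congrFun (eq_of_eqOn_schwartzMap
    (S := fun f => compMat (transposeGL A) (𝓕 (compMat A f)))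
    (T := fun f : L2 d => |(A : Matrix (Fin d) (Fin d) ℝ).det|⁻¹ • 𝓕 f)
    ((continuous_compMat _).comp (continuous_fourier.comp (continuous_compMat A)))
    ((continuous_const_smul (T := L2 d) _).comp continuous_fourier) fun g => ?_) f
  let gA := SchwartzMap.compCLMOfContinuousLinearEquiv ℂ (euclideanCLE A) g
  have toLp_comp : compMat A (g.toLp 2 : L2 d) = gA.toLp 2 := by
    apply Lp.ext
    filter_upwards [compMat_ae A (g.toLp 2), schwartzMap_toLp_ae gA,
      (quasiMP A).ae (schwartzMap_toLp_ae g)] with x h1 h2 h3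
    rw [h1, h2, h3]
    rfl
  simp only [toLp_comp, SchwartzMap.toLp_fourier_eq]
  apply Lp.ext
  filter_upwards [compMat_ae (transposeGL A) ((𝓕 gA).toLp 2),
    (quasiMP (transposeGL A)).ae (schwartzMap_toLp_ae (𝓕 gA)),
    Lp.coeFn_smul |(A : Matrix (Fin d) (Fin d) ℝ).det|⁻¹ ((𝓕 g).toLp 2 : L2 d),
    schwartzMap_toLp_ae (𝓕 g)] with ξ h1 h2 h3 h4
  rw [h1, h2, h3, Pi.smul_apply, h4, SchwartzMap.fourier_coe, SchwartzMap.fourier_coe]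
  exact fourier_comp_euclideanCLE A g ξ

theorem fourier_renormDilation_inv (A : GL (Fin d) ℝ) (f : L2 d) :
    𝓕 ((renormDilation A)⁻¹ f) = compMat (transposeGL A) (𝓕 f) := by
  obtain ⟨g, rfl⟩ := (renormDilation A).surjective f
  have inv_apply : (renormDilation A)⁻¹ (renormDilation A g) = g :=
    (renormDilation A).symm_apply_apply g
  have apply_eq : renormDilation A g =
      ((|(A : Matrix (Fin d) (Fin d) ℝ).det| : ℝ) : ℂ) • compMat A g := rfl
  have compMat_smul (c : ℂ) (h : L2 d) :
      compMat (transposeGL A) (c • h) = c • compMat (transposeGL A) h :=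
    map_smul (compMatEquiv (transposeGL A)) c h
  rw [inv_apply, apply_eq, FourierTransform.fourier_smul, compMat_smul, compMat_fourier_compMat,
    Complex.coe_smul]
  exact (smul_inv_smul₀ (abs_ne_zero.2 A.det.ne_zero) _).symm

theorem fourier_renormDilation_zpow_ae (A : GL (Fin d) ℝ) (j : ℕ) (f : L2 d) :
    ∀ᵐ ξ, (𝓕 ((renormDilation A ^ (-(j : ℤ))) f) : L2 d) ξ = (𝓕 f : L2 d) (adjPow A j ξ) := by
  induction j with
  | zero => simp [adjPow]
  | succ j ih =>
    have zpow_succ : (renormDilation A ^ (-((j + 1 : ℕ) : ℤ))) f =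
        (renormDilation A)⁻¹ ((renormDilation A ^ (-(j : ℤ))) f) := by
      rw [← LinearEquiv.mul_apply, ← zpow_neg_one, ← zpow_add, Nat.cast_succ, neg_add_rev]
    rw [zpow_succ, fourier_renormDilation_inv]
    filter_upwards [compMat_ae (transposeGL A) (𝓕 ((renormDilation A ^ (-(j : ℤ))) f)),
      (quasiMP (transposeGL A)).ae ih] with ξ h1 h2
    rw [h1, h2, adjPow, adjPow, pow_succ, Matrix.toLpLin_mul_same]
    rfl

theorem ae_inner_ne {E : Type*} [NormedAddCommGroup E] [InnerProductSpace ℝ E]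
    [FiniteDimensional ℝ E] [MeasurableSpace E] [BorelSpace E] (μ : Measure E)
    [μ.IsAddHaarMeasure] {c : E} (hc : c ≠ 0) (t : ℝ) : ∀ᵐ ξ ∂μ, inner ℝ c ξ ≠ t := by
  let hyperplane : AffineSubspace ℝ E := AffineSubspace.mk' ((t / ‖c‖ ^ 2) • c) (ℝ ∙ c)ᗮ
  have proper : hyperplane ≠ ⊤ := fun htop => hc <| by
    have hdir : (ℝ ∙ c)ᗮ = ⊤ := by
      rw [← AffineSubspace.direction_mk' ((t / ‖c‖ ^ 2) • c) (ℝ ∙ c)ᗮ,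
        ← AffineSubspace.direction_top ℝ E E, ← htop]
    simpa using hdir
  filter_upwards [measure_eq_zero_iff_ae_notMem.1
    (Measure.addHaar_affineSubspace μ hyperplane proper)] with ξ hξ heq
  refine hξ (AffineSubspace.mem_mk'.2 (Submodule.mem_orthogonal_singleton_iff_inner_right.2 ?_))
  rw [vsub_eq_sub, inner_sub_right, heq, inner_smul_right, real_inner_self_eq_norm_sq,
    div_mul_cancel₀ _ (by simpa using hc), sub_self]

theorem exists_int_of_char_eq {a b ξ : Eu d} (h : char a ξ = char b ξ) :
    ∃ n : ℤ, inner ℝ (a - b) ξ = n := by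
  rw [char, char, Real.fourierChar_apply, Real.fourierChar_apply,
    Complex.exp_eq_exp_iff_exists_int] at h
  obtain ⟨n, hn⟩ := h
  refine ⟨-n, ?_⟩
  have : (((inner ℝ (a - b) ξ : ℝ) : ℂ) + n) * (2 * Real.pi * Complex.I) = 0 := by
    rw [inner_sub_left]
    push_cast at hn ⊢
    linear_combination -hn
  have := (mul_eq_zero.1 this).resolve_right Complex.two_pi_I_ne_zero
  exact_mod_cast eq_neg_of_add_eq_zero_left this

theorem eq_zero_of_translation_eq {a b : Eu d} (hab : a ≠ b) {g : L2 d}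
    (h : translation a g = translation b g) : g = 0 := by
  have modulation_eq : modulation a (𝓕 g) = modulation b (𝓕 g) := by
    rw [← fourier_translation, h, fourier_translation]
  have fourier_eq_zero : (𝓕 g : L2 d) = 0 := by
    refine Lp.ext <| Filter.EventuallyEq.trans ?_ (Lp.coeFn_zero ℂ 2 volume).symm
    filter_upwards [ae_all_iff.2 fun n : ℤ => ae_inner_ne volume (sub_ne_zero.2 hab) (n : ℝ),
      modulation_eq ▸ modulation_ae a (𝓕 g), modulation_ae b (𝓕 g)] with ξ noninteger ha hb
    by_contra hne
    obtain ⟨n, hn⟩ := exists_int_of_char_eq (mul_right_cancel₀ hne (ha.symm.trans hb))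
    exact noninteger n hn
  rw [← norm_eq_zero, ← Lp.norm_fourier_eq, fourier_eq_zero, norm_zero]

end Fourier

section UnitCube

theorem intPt_add (m k : Fin d → ℤ) : intPt (m + k) = intPt m + intPt k := by
  ext i
  simp [intPt]

theorem char_add_intPt (z m : Fin d → ℤ) (ξ : Eu d) :
    char (intPt z) (ξ + intPt m) = char (intPt z) ξ := by
  have inner_eq : inner ℝ (intPt z) (intPt m) = ((∑ i, m i * z i : ℤ) : ℝ) := by
    simp [PiLp.inner_apply, intPt]
  rw [char, char, inner_add_right, neg_add, AddChar.map_add_eq_mul, inner_eq, ← Int.cast_neg,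
    Circle.coe_mul, Real.fourierChar_apply, Real.fourierChar_apply]
  convert mul_one _
  rw [← Complex.exp_int_mul_two_pi_mul_I (-∑ i, m i * z i)]
  push_cast
  ring_nf

/-- The half-open unit cube `(0, 1]^d`, a fundamental domain of `ℤ^d`. -/
def unitCube (d : ℕ) : Set (Eu d) := {x | ∀ i, x i ∈ Set.Ioc 0 1}

theorem unitCube_eq_preimage :
    unitCube d = WithLp.ofLp ⁻¹' Set.univ.pi fun _ => Set.Ioc (0 : ℝ) 1 := by
  ext x
  simp [unitCube]

theorem measurableSet_unitCube : MeasurableSet (unitCube d) :=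
  unitCube_eq_preimage ▸ (PiLp.volume_preserving_ofLp (Fin d)).measurable
    (MeasurableSet.univ_pi fun _ => measurableSet_Ioc)

theorem volume_unitCube_lt_top : volume (unitCube d) < ⊤ := by
  rw [unitCube_eq_preimage, (PiLp.volume_preserving_ofLp (Fin d)).measure_preimage
    (MeasurableSet.univ_pi fun _ => measurableSet_Ioc).nullMeasurableSet, Real.volume_pi_Ioc]
  simp

theorem exists_sub_intPt_mem_unitCube (x : Eu d) : ∃ m, x - intPt m ∈ unitCube d := by
  refine ⟨fun i => ⌈x i⌉ - 1, fun i => ?_⟩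
  simp only [PiLp.sub_apply, intPt, Set.mem_Ioc, Int.cast_sub, Int.cast_one]
  constructor <;> linarith [Int.ceil_lt_add_one (x i), Int.le_ceil (x i)]

/-- Lebesgue measure on the unit cube. -/
def cubeMeasure (d : ℕ) : Measure (Eu d) := volume.restrict (unitCube d)

instance : IsFiniteMeasure (cubeMeasure d) := ⟨by
  rw [cubeMeasure, Measure.restrict_apply_univ]
  exact volume_unitCube_lt_top⟩

theorem ae_iff_forall_ae_cubeMeasure {p : Eu d → Prop} :
    (∀ᵐ ξ, p ξ) ↔ ∀ m, ∀ᵐ ξ ∂cubeMeasure d, p (ξ + intPt m) := by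
  refine ⟨fun h m => ae_restrict_of_ae
    ((measurePreserving_add_right volume (intPt m)).quasiMeasurePreserving.ae h), fun h => ?_⟩
  have h' : ∀ᵐ ξ, ∀ m, ξ - intPt m ∈ unitCube d → p ξ := ae_all_iff.2 fun m => by
    filter_upwards [(measurePreserving_sub_right volume (intPt m)).quasiMeasurePreserving.ae
      ((ae_restrict_iff' measurableSet_unitCube).1 (h m))] with ξ hξ
    simpa only [sub_add_cancel] using hξ
  filter_upwards [h'] with ξ hξ
  obtain ⟨m, hm⟩ := exists_sub_intPt_mem_unitCube ξ
  exact hξ m hm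

end UnitCube

section Torus

-- The measure with respect to which Mathlib defines Fourier coefficients on `UnitAddTorus`.
local instance : MeasureSpace UnitAddCircle := ⟨AddCircle.haarAddCircle⟩

local instance : Measure.IsAddHaarMeasure (volume : Measure UnitAddCircle) :=
  inferInstanceAs (Measure.IsAddHaarMeasure AddCircle.haarAddCircle)

local instance : IsProbabilityMeasure (volume : Measure UnitAddCircle) :=
  inferInstanceAs (IsProbabilityMeasure AddCircle.haarAddCircle)

/-- The section of the quotient map `ℝ^d → ℝ^d/ℤ^d` with values in the unit cube. It transports
Mathlib's Fourier series on the torus to the unit cube. -/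
def torusSection (t : UnitAddTorus (Fin d)) : Eu d :=
  WithLp.toLp 2 (UnitAddTorus.measurableEquivPiIoc (0 : Fin d → ℝ) t).1

theorem measurePreserving_torusSection :
    MeasurePreserving (torusSection (d := d)) volume (cubeMeasure d) := by
  have hs : MeasurableSet {x : Fin d → ℝ | ∀ i, x i ∈ Set.Ioc ((0 : Fin d → ℝ) i)
      ((0 : Fin d → ℝ) i + 1)} :=
    MeasurableSet.univ_pi' fun _ => measurableSet_Ioc
  have toLp := (PiLp.volume_preserving_toLp (Fin d)).restrict_preimage
    (measurableSet_unitCube (d := d))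
  have preimage_eq : (WithLp.toLp 2 : (Fin d → ℝ) → Eu d) ⁻¹' unitCube d = {x : Fin d → ℝ |
      ∀ i, x i ∈ Set.Ioc ((0 : Fin d → ℝ) i) ((0 : Fin d → ℝ) i + 1)} := by
    ext x
    simp [unitCube]
  rw [preimage_eq] at toLp
  exact toLp.comp ((measurePreserving_subtype_coe hs).comp
    (UnitAddTorus.measurePreserving_equivPiIoc 0))

theorem mFourier_neg_eq_char (z : Fin d → ℤ) (t : UnitAddTorus (Fin d)) :
    UnitAddTorus.mFourier (-z) t = char (intPt z) (torusSection t) := by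
  have coe_torusSection (i : Fin d) : t i = ((torusSection t i : ℝ) : UnitAddCircle) :=
    congrFun ((UnitAddTorus.measurableEquivPiIoc (0 : Fin d → ℝ)).symm_apply_apply t).symm i
  rw [UnitAddTorus.mFourier, ContinuousMap.coe_mk, char, Real.fourierChar_apply]
  simp_rw [coe_torusSection, fourier_coe_apply]
  rw [← Complex.exp_sum]
  congr 1
  simp only [PiLp.inner_apply, intPt, Pi.neg_apply, RCLike.inner_apply, conj_trivial]
  push_cast
  rw [← Finset.sum_neg_distrib, Finset.mul_sum, Finset.sum_mul]
  refine Finset.sum_congr rfl fun i _ => ?_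
  ring

theorem integral_comp_torusSection {h : Eu d → ℂ}
    (hh : AEStronglyMeasurable h (cubeMeasure d)) :
    ∫ t, h (torusSection t) = ∫ ξ, h ξ ∂cubeMeasure d := by
  rw [← measurePreserving_torusSection.map_eq] at hh ⊢
  exact (integral_map measurePreserving_torusSection.aemeasurable hh).symm

theorem mFourierCoeff_comp_torusSection {c : Eu d → ℂ} (hc : MemLp c 2 (cubeMeasure d))
    (z : Fin d → ℤ) :
    UnitAddTorus.mFourierCoeff
      (hc.comp_measurePreserving measurePreserving_torusSection).toLp z =
        ∫ ξ, char (intPt z) ξ * c ξ ∂cubeMeasure d := by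
  rw [← integral_comp_torusSection (h := fun ξ => char (intPt z) ξ * c ξ)
    ((continuous_char _).aestronglyMeasurable.mul hc.1), UnitAddTorus.mFourierCoeff]
  refine integral_congr_ae ?_
  filter_upwards [(hc.comp_measurePreserving measurePreserving_torusSection).coeFn_toLp] with t ht
  rw [ht, mFourier_neg_eq_char, smul_eq_mul, Function.comp_apply]

theorem hasSum_conj_integral_char_mul {a b : Eu d → ℂ} (ha : MemLp a 2 (cubeMeasure d))
    (hb : MemLp b 2 (cubeMeasure d)) :
    HasSum (fun z : Fin d → ℤ =>
      (starRingEnd ℂ) (∫ ξ, char (intPt z) ξ * a ξ ∂cubeMeasure d) *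
        ∫ ξ, char (intPt z) ξ * b ξ ∂cubeMeasure d)
      (∫ ξ, (starRingEnd ℂ) (a ξ) * b ξ ∂cubeMeasure d) := by
  have ha' := ha.comp_measurePreserving measurePreserving_torusSection
  have hb' := hb.comp_measurePreserving measurePreserving_torusSection
  simp_rw [← mFourierCoeff_comp_torusSection ha, ← mFourierCoeff_comp_torusSection hb]
  convert UnitAddTorus.hasSum_prod_mFourierCoeff ha'.toLp hb'.toLp using 1
  rw [← integral_comp_torusSection (h := fun ξ => (starRingEnd ℂ) (a ξ) * b ξ)
    ((Complex.continuous_conj.comp_aestronglyMeasurable ha.1).mul hb.1)]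
  refine integral_congr_ae ?_
  filter_upwards [ha'.coeFn_toLp, hb'.coeFn_toLp] with t h1 h2
  rw [h1, h2, Function.comp_apply, Function.comp_apply]

end Torus

section ShiftInvariant

theorem ae_summable_and_integrable_tsum {ι X E : Type*} [Countable ι] [MeasurableSpace X]
    {μ : Measure X} [NormedAddCommGroup E] [CompleteSpace E] {f : ι → X → E}
    (hf : ∀ i, Integrable (f i) μ) (hs : Summable fun i => ∫ x, ‖f i x‖ ∂μ) :
    (∀ᵐ x ∂μ, Summable fun i => f i x) ∧ Integrable (fun x => ∑' i, f i x) μ := by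
  have norm_tsum_ne_top : ∑' i, ‖(hf i).toL1 (f i)‖ₑ ≠ ⊤ := by
    simpa only [Integrable.enorm_toL1, ← ofReal_integral_norm_eq_lintegral_enorm (hf _)] using
      hs.tsum_ofReal_ne_top
  have hasSum : ∀ᵐ x ∂μ, HasSum (fun i => f i x) ((∑' i, (hf i).toL1 (f i) : Lp E 1 μ) x) := by
    filter_upwards [Lp.hasSum_coeFn_tsum norm_tsum_ne_top,
      ae_all_iff.2 fun i => (hf i).coeFn_toL1] with x hx hcoe
    simpa only [hcoe] using hx
  exact ⟨hasSum.mono fun x hx => hx.summable,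
    (L1.integrable_coeFn (∑' i, (hf i).toL1 (f i))).congr
      (hasSum.mono fun x hx => hx.tsum_eq.symm)⟩

theorem summable_integral_norm_conj_mul {ι X : Type*} [MeasurableSpace X] {μ : Measure X}
    {f g : ι → X → ℂ} (hf : ∀ i, MemLp (f i) 2 μ) (hg : ∀ i, MemLp (g i) 2 μ)
    (hsf : Summable fun i => ∫ x, ‖f i x‖ ^ 2 ∂μ) (hsg : Summable fun i => ∫ x, ‖g i x‖ ^ 2 ∂μ) :
    Summable fun i => ∫ x, ‖(starRingEnd ℂ) (f i x) * g i x‖ ∂μ := by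
  refine (hsf.add hsg).of_nonneg_of_le (fun i => by positivity) fun i => ?_
  have hf2 := (hf i).integrable_norm_pow two_ne_zero
  have hg2 := (hg i).integrable_norm_pow two_ne_zero
  rw [← integral_add hf2 hg2]
  refine integral_mono_of_nonneg (.of_forall fun x => by positivity) (hf2.add hg2)
    (.of_forall fun x => ?_)
  simp only [norm_mul, RCLike.norm_conj]
  nlinarith [sq_nonneg (‖f i x‖ - ‖g i x‖), sq_nonneg (‖f i x‖ + ‖g i x‖)]

/-- The `m`-th coordinate `ξ ↦ 𝓕 f (ξ + m)` of the fiber of `f` in the fiberization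
`L²(ℝ^d) ≅ L²((0, 1]^d, ℓ²(ℤ^d))`. -/
def fiber (f : L2 d) (m : Fin d → ℤ) (ξ : Eu d) : ℂ := (𝓕 f : L2 d) (ξ + intPt m)

theorem memLp_fiber (f : L2 d) (m : Fin d → ℤ) : MemLp (fiber f m) 2 (cubeMeasure d) :=
  ((Lp.memLp (𝓕 f)).comp_measurePreserving (measurePreserving_add_right volume (intPt m))).restrict
    (unitCube d)

theorem integrable_conj_fiber_mul_fiber (f g : L2 d) (m n : Fin d → ℤ) :
    Integrable (fun ξ => (starRingEnd ℂ) (fiber f m ξ) * fiber g n ξ) (cubeMeasure d) :=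
  (memLp_fiber f m).star.integrable_mul (memLp_fiber g n)

theorem fiber_translation_ae (z m : Fin d → ℤ) (f : L2 d) :
    ∀ᵐ ξ ∂cubeMeasure d, fiber (translation (intPt z) f) m ξ = char (intPt z) ξ * fiber f m ξ := by
  filter_upwards [ae_iff_forall_ae_cubeMeasure.1 (modulation_ae (intPt z) (𝓕 f)) m] with ξ h
  rw [fiber, fourier_translation, h, char_add_intPt, fiber]

theorem volume_preimage_sub_inter_unitCube_ne_top (m : Fin d → ℤ) {E : Set (Eu d)}
    (hE : MeasurableSet E) : volume ((· - intPt m) ⁻¹' (E ∩ unitCube d)) ≠ ⊤ := by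
  rw [(measurePreserving_sub_right volume (intPt m)).measure_preimage
    (hE.inter measurableSet_unitCube).nullMeasurableSet]
  exact ((measure_mono Set.inter_subset_right).trans_lt volume_unitCube_lt_top).ne

/-- The function whose Fourier transform is the indicator of `m + (E ∩ (0, 1]^d)`. -/
def bandIndicator (m : Fin d → ℤ) {E : Set (Eu d)} (hE : MeasurableSet E) : L2 d :=
  𝓕⁻ (indicatorConstLp 2 (measurable_sub_const (intPt m) (hE.inter measurableSet_unitCube))
    (volume_preimage_sub_inter_unitCube_ne_top m hE) 1 : L2 d)

theorem inner_bandIndicator (m : Fin d → ℤ) {E : Set (Eu d)} (hE : MeasurableSet E) (f : L2 d) :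
    inner ℂ (bandIndicator m hE) f = ∫ ξ in E, fiber f m ξ ∂cubeMeasure d := by
  have shift := (measurePreserving_sub_right volume (intPt m)).setIntegral_preimage_emb
    (Homeomorph.subRight (intPt m)).measurableEmbedding (fiber f m) (E ∩ unitCube d)
  simp only [fiber, sub_add_cancel] at shift
  rw [← Lp.inner_fourier_eq, bandIndicator, FourierTransform.fourier_fourierInv_eq,
    L2.inner_indicatorConstLp_one, cubeMeasure, Measure.restrict_restrict hE, shift]
  rfl

/-- The band indicators: a total set, on which mixed operators of shift-invariant systems are
explicit integrals. -/
def bandIndicators (d : ℕ) : Set (L2 d) :=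
  {v | ∃ (m : Fin d → ℤ) (E : Set (Eu d)) (hE : MeasurableSet E), v = bandIndicator m hE}

theorem eq_zero_of_forall_inner_bandIndicators {f : L2 d}
    (h : ∀ v ∈ bandIndicators d, inner ℂ v f = 0) : f = 0 := by
  have fourier_eq_zero : (𝓕 f : L2 d) = 0 := by
    refine Lp.ext <| Filter.EventuallyEq.trans ?_ (Lp.coeFn_zero ℂ 2 volume).symm
    refine ae_iff_forall_ae_cubeMeasure.2 fun m => ?_
    refine ((memLp_fiber f m).integrable (by norm_num)).ae_eq_zero_of_forall_setIntegral_eq_zero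
      fun E hE _ => ?_
    rw [← inner_bandIndicator m hE, h _ ⟨m, E, hE, rfl⟩]
  rw [← norm_eq_zero, ← Lp.norm_fourier_eq, fourier_eq_zero, norm_zero]

theorem inner_bandIndicator_translation (m z : Fin d → ℤ) {E : Set (Eu d)} (hE : MeasurableSet E)
    (f : L2 d) : inner ℂ (bandIndicator m hE) (translation (intPt z) f) =
      ∫ ξ, char (intPt z) ξ * E.indicator (fiber f m) ξ ∂cubeMeasure d := by
  rw [inner_bandIndicator, ← integral_indicator hE]
  refine integral_congr_ae ?_
  filter_upwards [fiber_translation_ae z m f] with ξ h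
  by_cases hξ : ξ ∈ E
  · simp only [Set.indicator_of_mem hξ, h]
  · simp only [Set.indicator_of_notMem hξ, mul_zero]

theorem hasSum_inner_translation (m n : Fin d → ℤ) {E E' : Set (Eu d)} (hE : MeasurableSet E)
    (hE' : MeasurableSet E') (f g : L2 d) :
    HasSum (fun z : Fin d → ℤ => inner ℂ (translation (intPt z) f) (bandIndicator m hE) *
        inner ℂ (bandIndicator n hE') (translation (intPt z) g))
      (∫ ξ in E ∩ E', (starRingEnd ℂ) (fiber f m ξ) * fiber g n ξ ∂cubeMeasure d) := by
  have parseval := hasSum_conj_integral_char_mul ((memLp_fiber f m).indicator hE)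
    ((memLp_fiber g n).indicator hE')
  simp only [← inner_bandIndicator_translation m _ hE f,
    ← inner_bandIndicator_translation n _ hE' g, inner_conj_symm] at parseval
  rw [← integral_indicator (hE.inter hE')]
  convert parseval using 3 with ξ
  by_cases hξ : ξ ∈ E <;> by_cases hξ' : ξ ∈ E' <;> simp [Set.indicator, hξ, hξ']

theorem hasSum_norm_inner_translation_sq (m : Fin d → ℤ) (f : L2 d) :
    HasSum (fun z : Fin d → ℤ =>
        ‖inner ℂ (translation (intPt z) f) (bandIndicator m MeasurableSet.univ)‖ ^ 2)
      (∫ ξ, ‖fiber f m ξ‖ ^ 2 ∂cubeMeasure d) := by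
  have h := hasSum_inner_translation m m MeasurableSet.univ MeasurableSet.univ f f
  simp only [Set.inter_self, Measure.restrict_univ, RCLike.conj_mul,
    ← RCLike.ofReal_pow, integral_ofReal] at h
  refine Complex.hasSum_ofReal.1 ?_
  convert h using 2 with z
  · rw [← inner_conj_symm (translation _ f), RCLike.conj_mul, RCLike.norm_conj]
    push_cast
    rfl
  · rfl

variable {Γ : Type*}

/-- The shift-invariant system of all integer translates of the generators `F γ`. -/
def shiftSystem (F : Γ → L2 d) : (Fin d → ℤ) × Γ → L2 d :=
  fun p => translation (intPt p.1) (F p.2)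

theorem mixedOp_shiftSystem_translation {F G : Γ → L2 d} (hF : IsBessel (shiftSystem F))
    (hG : IsBessel (shiftSystem G)) (a : Fin d → ℤ) :
    Function.Commute (mixedOp (shiftSystem F) (shiftSystem G)) (translation (intPt a)) := by
  intro v
  let shift : (Fin d → ℤ) × Γ ≃ (Fin d → ℤ) × Γ := (Equiv.addLeft a).prodCongr (.refl Γ)
  have translation_comp (F : Γ → L2 d) :
      translationIsometry (intPt a) ∘ shiftSystem F = shiftSystem F ∘ shift := funext fun p => by
    simp [shiftSystem, shift, coe_translationIsometry, translation_translation, intPt_add]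
  have h := mixedOp_map hF hG (translationIsometry (intPt a)) (translationIsometry (intPt a)) v
  rwa [translation_comp, translation_comp, mixedOp_comp_equiv] at h

theorem IsBessel.summable_integral_norm_fiber_sq {F : Γ → L2 d} (hF : IsBessel (shiftSystem F))
    (m : Fin d → ℤ) : Summable fun γ => ∫ ξ, ‖fiber (F γ) m ξ‖ ^ 2 ∂cubeMeasure d := by
  obtain ⟨C, hC⟩ := hF
  have h := ((hC (bandIndicator m MeasurableSet.univ)).1).prod_symm.prod
  simpa only [Prod.swap_prod_mk, shiftSystem, (hasSum_norm_inner_translation_sq m _).tsum_eq]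
    using h

theorem IsBessel.summable_integral_norm_conj_fiber_mul_fiber {F G : Γ → L2 d}
    (hF : IsBessel (shiftSystem F)) (hG : IsBessel (shiftSystem G)) (m n : Fin d → ℤ) :
    Summable fun γ =>
      ∫ ξ, ‖(starRingEnd ℂ) (fiber (F γ) m ξ) * fiber (G γ) n ξ‖ ∂cubeMeasure d :=
  summable_integral_norm_conj_mul (fun γ => memLp_fiber (F γ) m) (fun γ => memLp_fiber (G γ) n)
    (hF.summable_integral_norm_fiber_sq m) (hG.summable_integral_norm_fiber_sq n)

/-- The `(m, n)` entry of the mixed dual Gramian of two families of generators. -/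
def dualGramian (F G : Γ → L2 d) (m n : Fin d → ℤ) (ξ : Eu d) : ℂ :=
  ∑' γ, (starRingEnd ℂ) (fiber (F γ) m ξ) * fiber (G γ) n ξ

variable [Countable Γ] {F G : Γ → L2 d}

theorem tsum_inner_shiftSystem (hF : IsBessel (shiftSystem F)) (hG : IsBessel (shiftSystem G))
    (m n : Fin d → ℤ) {E E' : Set (Eu d)} (hE : MeasurableSet E) (hE' : MeasurableSet E') :
    ∑' p, inner ℂ (shiftSystem F p) (bandIndicator m hE) *
        inner ℂ (bandIndicator n hE') (shiftSystem G p) =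
      ∫ ξ in E ∩ E', dualGramian F G m n ξ ∂cubeMeasure d := by
  have summable := (hF.hasSum_inner_mixedOp hG (bandIndicator m hE) (bandIndicator n hE')).summable
  have integrable (γ : Γ) := integrable_conj_fiber_mul_fiber (F γ) (G γ) m n
  have swap := hasSum_integral_of_summable_integral_norm
    (fun γ => (integrable γ).restrict (s := E ∩ E')) <|
      (hF.summable_integral_norm_conj_fiber_mul_fiber hG m n).of_nonneg_of_le
        (fun γ => by positivity) fun γ =>
          setIntegral_le_integral (integrable γ).norm (.of_forall fun ξ => norm_nonneg _)
  refine ((Equiv.prodComm Γ (Fin d → ℤ)).tsum_eq _).symm.trans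
    (((Equiv.prodComm Γ (Fin d → ℤ)).summable_iff.2 summable).tsum_prod.trans ?_)
  simp only [Function.comp_apply, Equiv.prodComm_apply, Prod.swap_prod_mk, shiftSystem,
    (hasSum_inner_translation m n hE hE' _ _).tsum_eq]
  exact swap.tsum_eq

theorem mixedOp_shiftSystem_eq_zero_iff_dualGramian (hF : IsBessel (shiftSystem F))
    (hG : IsBessel (shiftSystem G)) :
    mixedOp (shiftSystem F) (shiftSystem G) = 0 ↔
      ∀ m n, ∀ᵐ ξ ∂cubeMeasure d, dualGramian F G m n ξ = 0 := by
  rw [mixedOp_eq_zero_iff_of_total hF hG fun u => eq_zero_of_forall_inner_bandIndicators]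
  constructor
  · intro h m n
    have integrable := (ae_summable_and_integrable_tsum
      (fun γ => integrable_conj_fiber_mul_fiber (F γ) (G γ) m n)
      (hF.summable_integral_norm_conj_fiber_mul_fiber hG m n)).2
    refine integrable.ae_eq_zero_of_forall_setIntegral_eq_zero fun E hE _ => ?_
    have := tsum_inner_shiftSystem hF hG m n hE hE
    rwa [h _ ⟨m, E, hE, rfl⟩ _ ⟨n, E, hE, rfl⟩, Set.inter_self, eq_comm] at this
  · rintro h _ ⟨m, E, hE, rfl⟩ _ ⟨n, E', hE', rfl⟩
    rw [tsum_inner_shiftSystem hF hG, integral_eq_zero_of_ae (ae_restrict_of_ae (h m n))]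

theorem IsBessel.ae_summable_fourier (hF : IsBessel (shiftSystem F))
    (hG : IsBessel (shiftSystem G)) (k : Fin d → ℤ) :
    ∀ᵐ ξ, Summable fun γ =>
      (starRingEnd ℂ) ((𝓕 (F γ) : L2 d) ξ) * (𝓕 (G γ) : L2 d) (ξ + intPt k) := by
  refine ae_iff_forall_ae_cubeMeasure.2 fun m => ?_
  simpa only [fiber, intPt_add, add_assoc] using (ae_summable_and_integrable_tsum
    (fun γ => integrable_conj_fiber_mul_fiber (F γ) (G γ) m (m + k))
    (hF.summable_integral_norm_conj_fiber_mul_fiber hG m (m + k))).1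

theorem mixedOp_shiftSystem_eq_zero_iff (hF : IsBessel (shiftSystem F))
    (hG : IsBessel (shiftSystem G)) :
    mixedOp (shiftSystem F) (shiftSystem G) = 0 ↔ ∀ k : Fin d → ℤ, ∀ᵐ ξ,
      ∑' γ, (starRingEnd ℂ) ((𝓕 (F γ) : L2 d) ξ) * (𝓕 (G γ) : L2 d) (ξ + intPt k) = 0 := by
  simp only [mixedOp_shiftSystem_eq_zero_iff_dualGramian hF hG, ae_iff_forall_ae_cubeMeasure]
  refine Iff.trans ?_ forall_comm
  refine forall_congr' fun m => (Equiv.addLeft m).surjective.forall.trans ?_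
  simp only [Equiv.coe_addLeft, dualGramian, fiber, intPt_add, add_assoc]

end ShiftInvariant

section QuasiAffineSystems

theorem IsIntegralMatrix.exists_intPt {M : Matrix (Fin d) (Fin d) ℝ} (hM : IsIntegralMatrix M)
    (a : Fin d → ℤ) : ∃ b : Fin d → ℤ, Matrix.toEuclideanLin M (intPt a) = intPt b := by
  choose N hN using hM
  refine ⟨fun i => ∑ j, N i j * a j, ?_⟩
  ext i
  simp [intPt, Matrix.toLpLin_apply, Matrix.mulVec, dotProduct, hN]

theorem exists_toEuclideanLin_intPt_ne {M N : Matrix (Fin d) (Fin d) ℝ} (h : M ≠ N) :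
    ∃ a : Fin d → ℤ, Matrix.toEuclideanLin M (intPt a) ≠ Matrix.toEuclideanLin N (intPt a) := by
  contrapose! h
  ext i j
  have := congrArg (fun x : Eu d => x i) (h (Pi.single j 1))
  simpa [intPt, Matrix.toLpLin_apply, Matrix.mulVec, dotProduct, Pi.single_apply] using this

theorem eq_zero_of_dilation_recursion {A B : GL (Fin d) ℝ} {P R : L2 d → L2 d} {a b : Eu d}
    (hA : euclideanCLE A a = b) (hB : euclideanCLE B a ≠ b)
    (hP : Function.Commute P (translation a)) (hRa : Function.Commute R (translation a))
    (hRb : Function.Commute R (translation b))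
    (recursion : ∀ v, R (dilation A v) = P (dilation A v) + dilation B (R v)) : R = 0 := by
  funext v
  let c := (euclideanCLE B).symm b
  have a_ne_c : a ≠ c := fun h => hB (by rw [h, (euclideanCLE B).apply_symm_apply])
  have dilation_A : dilation A (translation b v) = translation a (dilation A v) :=
    hA ▸ dilation_translation A a v
  have dilation_B : dilation B (translation b (R v)) = translation c (dilation B (R v)) := by
    rw [← dilation_translation B c, (euclideanCLE B).apply_symm_apply]
  have h := recursion (translation b v)
  rw [dilation_A, hRb, dilation_B, hRa, hP, recursion, ← coe_translationIsometry, map_add] at h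
  exact (dilation B).map_eq_zero_iff.1 (eq_zero_of_translation_eq a_ne_c (add_left_cancel h))

variable {r : ℕ}

/-- The generators `D̃_A ^ (-j) ψ i`, `j > 0`, of the shift-invariant system formed by the negative
levels of a quasi-affine system; the index `(i, j)` stands for the exponent `-(j + 1)`. -/
def negGenerators (A : GL (Fin d) ℝ) (ψ : Fin r → L2 d) : Fin r × ℕ → L2 d :=
  fun p => (renormDilation A ^ (-((p.2 + 1 : ℕ) : ℤ))) (ψ p.1)

theorem fourier_negGenerators_ae (A : GL (Fin d) ℝ) (ψ : Fin r → L2 d) :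
    ∀ᵐ ξ, ∀ p,
      (𝓕 (negGenerators A ψ p) : L2 d) ξ = (𝓕 (ψ p.1) : L2 d) (adjPow A (p.2 + 1) ξ) :=
  ae_all_iff.2 fun p => fourier_renormDilation_zpow_ae A (p.2 + 1) (ψ p.1)

/-- The splitting of the index set of a quasi-affine system into the nonnegative levels, with the
level as first coordinate, and the negative levels, with the index of `shiftSystem`. -/
def levelEquiv (d r : ℕ) :
    (ℕ × (Fin d → ℤ) × Fin r) ⊕ ((Fin d → ℤ) × Fin r × ℕ) ≃ ℤ × (Fin d → ℤ) × Fin r :=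
  ((Equiv.refl _).sumCongr ((Equiv.prodAssoc _ _ _).symm.trans (Equiv.prodComm _ _))).trans <|
    (Equiv.sumProdDistrib ℕ ℕ _).symm.trans (Equiv.intEquivNatSumNat.symm.prodCongr (.refl _))

theorem quasiAffine_levelEquiv_inl (A : GL (Fin d) ℝ) (ψ : Fin r → L2 d) :
    quasiAffine A ψ ∘ levelEquiv d r ∘ Sum.inl =
      orbit (dilationIsometry A) (shiftSystem ψ) := by
  funext ⟨n, k⟩
  rw [orbit, dilationIsometry_pow_apply]
  change quasiAffine A ψ ((n : ℤ), k) = _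
  rw [quasiAffine, if_pos (Int.natCast_nonneg n)]
  rfl

theorem quasiAffine_levelEquiv_inr (A : GL (Fin d) ℝ) (ψ : Fin r → L2 d) :
    quasiAffine A ψ ∘ levelEquiv d r ∘ Sum.inr = shiftSystem (negGenerators A ψ) := by
  funext ⟨z, i, j⟩
  change quasiAffine A ψ (Int.negSucc j, z, i) = _
  rw [quasiAffine, if_neg (Int.negSucc_lt_zero j).not_ge]
  rfl

variable {A B : GL (Fin d) ℝ} {ψ φ : Fin r → L2 d}

theorem IsBessel.orbit_shiftSystem (hψ : IsBessel (quasiAffine A ψ)) :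
    IsBessel (orbit (dilationIsometry A) (shiftSystem ψ)) :=
  quasiAffine_levelEquiv_inl A ψ ▸
    hψ.comp_injective ((levelEquiv d r).injective.comp Sum.inl_injective)

theorem IsBessel.shiftSystem_negGenerators (hψ : IsBessel (quasiAffine A ψ)) :
    IsBessel (shiftSystem (negGenerators A ψ)) :=
  quasiAffine_levelEquiv_inr A ψ ▸
    hψ.comp_injective ((levelEquiv d r).injective.comp Sum.inr_injective)

theorem mixedOp_quasiAffine (hψ : IsBessel (quasiAffine A ψ)) (hφ : IsBessel (quasiAffine B φ))
    (v : L2 d) :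
    mixedOp (quasiAffine A ψ) (quasiAffine B φ) v =
      mixedOp (orbit (dilationIsometry A) (shiftSystem ψ))
          (orbit (dilationIsometry B) (shiftSystem φ)) v +
        mixedOp (shiftSystem (negGenerators A ψ)) (shiftSystem (negGenerators B φ)) v := by
  rw [← mixedOp_comp_equiv (levelEquiv d r), mixedOp_sum
    (hψ.comp_injective (levelEquiv d r).injective) (hφ.comp_injective (levelEquiv d r).injective)]
  simp only [Function.comp_assoc, quasiAffine_levelEquiv_inl, quasiAffine_levelEquiv_inr]

theorem mixedOp_orbit_eq_zero_of_mixedOp_quasiAffine_eq_zero (hψ : IsBessel (quasiAffine A ψ))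
    (hφ : IsBessel (quasiAffine B φ)) {a b : Fin d → ℤ}
    (hA : euclideanCLE A (intPt a) = intPt b) (hB : euclideanCLE B (intPt a) ≠ intPt b)
    (h : mixedOp (quasiAffine A ψ) (quasiAffine B φ) = 0) :
    mixedOp (orbit (dilationIsometry A) (shiftSystem ψ))
      (orbit (dilationIsometry B) (shiftSystem φ)) = 0 := by
  have orbit_eq_neg (v : L2 d) : mixedOp (orbit (dilationIsometry A) (shiftSystem ψ))
      (orbit (dilationIsometry B) (shiftSystem φ)) v =
        -mixedOp (shiftSystem (negGenerators A ψ)) (shiftSystem (negGenerators B φ)) v := by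
    rw [eq_neg_iff_add_eq_zero, ← mixedOp_quasiAffine hψ hφ, h, Pi.zero_apply]
  have orbit_commute (k : Fin d → ℤ) :
      Function.Commute (mixedOp (orbit (dilationIsometry A) (shiftSystem ψ))
        (orbit (dilationIsometry B) (shiftSystem φ))) (translation (intPt k)) := fun v => by
    rw [orbit_eq_neg, orbit_eq_neg, mixedOp_shiftSystem_translation hψ.shiftSystem_negGenerators
      hφ.shiftSystem_negGenerators, ← coe_translationIsometry, map_neg]
  exact eq_zero_of_dilation_recursion hA hB
    (mixedOp_shiftSystem_translation hψ.orbit_shiftSystem.of_orbit hφ.orbit_shiftSystem.of_orbit a)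
    (orbit_commute a) (orbit_commute b)
    (mixedOp_orbit_apply hψ.orbit_shiftSystem hφ.orbit_shiftSystem)

theorem mixedOp_quasiAffine_eq_zero_iff (hψ : IsBessel (quasiAffine A ψ))
    (hφ : IsBessel (quasiAffine B φ)) {a b : Fin d → ℤ}
    (hA : euclideanCLE A (intPt a) = intPt b) (hB : euclideanCLE B (intPt a) ≠ intPt b) :
    mixedOp (quasiAffine A ψ) (quasiAffine B φ) = 0 ↔
      mixedOp (shiftSystem ψ) (shiftSystem φ) = 0 ∧
        mixedOp (shiftSystem (negGenerators A ψ)) (shiftSystem (negGenerators B φ)) = 0 := by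
  constructor
  · intro h
    have orbit_eq_zero :=
      mixedOp_orbit_eq_zero_of_mixedOp_quasiAffine_eq_zero hψ hφ hA hB h
    refine ⟨funext fun v => ?_, funext fun v => ?_⟩
    · obtain ⟨u, rfl⟩ := (dilationIsometry A).surjective v
      simpa [orbit_eq_zero] using
        (mixedOp_orbit_apply hψ.orbit_shiftSystem hφ.orbit_shiftSystem u).symm
    · simpa [orbit_eq_zero, h] using (mixedOp_quasiAffine hψ hφ v).symm
  · rintro ⟨level_zero, negative⟩
    funext v
    rw [mixedOp_quasiAffine hψ hφ, mixedOp_orbit_eq_zero hψ.orbit_shiftSystem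
      hφ.orbit_shiftSystem level_zero, negative, Pi.zero_apply, add_zero]

theorem ae_forall_conj_fourier_negGenerators_mul (A B : GL (Fin d) ℝ) (ψ φ : Fin r → L2 d)
    (k : Fin d → ℤ) : ∀ᵐ ξ, ∀ p,
      (starRingEnd ℂ) ((𝓕 (negGenerators A ψ p) : L2 d) ξ) *
          (𝓕 (negGenerators B φ p) : L2 d) (ξ + intPt k) =
        (starRingEnd ℂ) ((𝓕 (ψ p.1) : L2 d) (adjPow A (p.2 + 1) ξ)) *
          (𝓕 (φ p.1) : L2 d) (adjPow B (p.2 + 1) (ξ + intPt k)) := by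
  filter_upwards [fourier_negGenerators_ae A ψ,
    (measurePreserving_add_right volume (intPt k)).quasiMeasurePreserving.ae
      (fourier_negGenerators_ae B φ)] with ξ hψ hφ p
  rw [hψ, hφ]

theorem IsBessel.ae_summable_adjPow (hψ : IsBessel (quasiAffine A ψ))
    (hφ : IsBessel (quasiAffine B φ)) (k : Fin d → ℤ) :
    ∀ᵐ ξ, Summable fun p : Fin r × ℕ =>
      (starRingEnd ℂ) ((𝓕 (ψ p.1) : L2 d) (adjPow A (p.2 + 1) ξ)) *
        (𝓕 (φ p.1) : L2 d) (adjPow B (p.2 + 1) (ξ + intPt k)) := by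
  filter_upwards [hψ.shiftSystem_negGenerators.ae_summable_fourier hφ.shiftSystem_negGenerators k,
    ae_forall_conj_fourier_negGenerators_mul A B ψ φ k] with ξ summable eq
  simpa only [eq] using summable

theorem mixedOp_negGenerators_eq_zero_iff (hψ : IsBessel (quasiAffine A ψ))
    (hφ : IsBessel (quasiAffine B φ)) :
    mixedOp (shiftSystem (negGenerators A ψ)) (shiftSystem (negGenerators B φ)) = 0 ↔
      ∀ k : Fin d → ℤ, ∀ᵐ ξ,
        ∑ i, ∑' j : ℕ, (starRingEnd ℂ) ((𝓕 (ψ i) : L2 d) (adjPow A (j + 1) ξ)) *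
          (𝓕 (φ i) : L2 d) (adjPow B (j + 1) (ξ + intPt k)) = 0 := by
  rw [mixedOp_shiftSystem_eq_zero_iff hψ.shiftSystem_negGenerators hφ.shiftSystem_negGenerators]
  refine forall_congr' fun k => Filter.eventually_congr ?_
  filter_upwards [hψ.ae_summable_adjPow hφ k,
    ae_forall_conj_fourier_negGenerators_mul A B ψ φ k] with ξ summable eq
  simp only [eq, summable.tsum_prod, tsum_fintype]

end QuasiAffineSystems

end QuasiAffine

end

theorem theoremT_general {d r : ℕ} (A B : GL (Fin d) ℝ)
    (hAB : ∃ a b : Fin d → ℤ,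
      Matrix.toEuclideanLin (A : Matrix (Fin d) (Fin d) ℝ) (intPt a) = intPt b ∧
        Matrix.toEuclideanLin (B : Matrix (Fin d) (Fin d) ℝ) (intPt a) ≠ intPt b)
    (ψ φ : Fin r → L2 d)
    (hψ : IsBessel (quasiAffine A ψ))
    (hφ : IsBessel (quasiAffine B φ)) :
    (∀ (k : Fin d → ℤ) (i : Fin r), ∀ᵐ ξ : Eu d,
      Summable (fun j : ℕ => (starRingEnd ℂ) ((𝓕 (ψ i) : L2 d) (adjPow A (j + 1) ξ)) *
        (𝓕 (φ i) : L2 d) (adjPow B (j + 1) (ξ + intPt k)))) ∧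
    (AreOrthogonal (quasiAffine A ψ) (quasiAffine B φ) ↔
      (∀ k : Fin d → ℤ, ∀ᵐ ξ : Eu d,
        ∑ i, (starRingEnd ℂ) ((𝓕 (ψ i) : L2 d) ξ) * (𝓕 (φ i) : L2 d) (ξ + intPt k) = 0) ∧
      (∀ k : Fin d → ℤ, ∀ᵐ ξ : Eu d,
        ∑ i, ∑' j : ℕ, (starRingEnd ℂ) ((𝓕 (ψ i) : L2 d) (adjPow A (j + 1) ξ)) *
          (𝓕 (φ i) : L2 d) (adjPow B (j + 1) (ξ + intPt k)) = 0)) := by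
  obtain ⟨a, b, hA, hB⟩ := hAB
  constructor
  · intro k i
    filter_upwards [hψ.ae_summable_adjPow hφ k] with ξ summable
    exact summable.prod_factor i
  · rw [areOrthogonal_iff_mixedOp_eq_zero hψ hφ, mixedOp_quasiAffine_eq_zero_iff hψ hφ hA hB,
      mixedOp_shiftSystem_eq_zero_iff hψ.orbit_shiftSystem.of_orbit hφ.orbit_shiftSystem.of_orbit,
      mixedOp_negGenerators_eq_zero_iff hψ hφ]
    simp only [tsum_fintype]

theorem theoremT {d r : ℕ} (A B : GL (Fin d) ℝ)
    (hA : IsExpansive (A : Matrix (Fin d) (Fin d) ℝ))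
    (hAint : IsIntegralMatrix (A : Matrix (Fin d) (Fin d) ℝ))
    (hB : IsExpansive (B : Matrix (Fin d) (Fin d) ℝ))
    (hAB : A ≠ B)
    (ψ φ : Fin r → L2 d)
    (hψ : IsBessel (quasiAffine A ψ))
    (hφ : IsBessel (quasiAffine B φ)) :
    (∀ (k : Fin d → ℤ) (i : Fin r), ∀ᵐ ξ : Eu d,
      Summable (fun j : ℕ => (starRingEnd ℂ) ((𝓕 (ψ i) : L2 d) (adjPow A (j + 1) ξ)) *
        (𝓕 (φ i) : L2 d) (adjPow B (j + 1) (ξ + intPt k)))) ∧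
    (AreOrthogonal (quasiAffine A ψ) (quasiAffine B φ) ↔
      (∀ k : Fin d → ℤ, ∀ᵐ ξ : Eu d,
        ∑ i, (starRingEnd ℂ) ((𝓕 (ψ i) : L2 d) ξ) * (𝓕 (φ i) : L2 d) (ξ + intPt k) = 0) ∧
      (∀ k : Fin d → ℤ, ∀ᵐ ξ : Eu d,
        ∑ i, ∑' j : ℕ, (starRingEnd ℂ) ((𝓕 (ψ i) : L2 d) (adjPow A (j + 1) ξ)) *
          (𝓕 (φ i) : L2 d) (adjPow B (j + 1) (ξ + intPt k)) = 0)) := by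
  obtain ⟨a, ha⟩ := exists_toEuclideanLin_intPt_ne (Units.val_injective.ne hAB)
  obtain ⟨b, hb⟩ := hAint.exists_intPt a
  exact theoremT_general A B ⟨a, b, hb, hb ▸ ha.symm⟩ ψ φ hψ hφ
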